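/- Let $G$ be a graph and let $d, p\ge 0$ be integers. A set $X\subseteq V(G)$ is a $d$-distance dominating set if for every $u\in V(G)\setminus X$ there is $x\in X$ at distance at most $d$ from $u$, and $X$ is a $p$-packing if any two different vertices of $X$ are at distance at least $p+1$. The $d$-distance $p$-packing domination number $\gamma_d^p(G)$ is the minimum size of a set of vertices of $G$ that is both a $d$-distance dominating set and a $p$-packing ($\infty$ if there is none). Let $d\ge 2$. If $T$ is a (finite) tree of order $n$, then $\gamma_d^2(T)$ is finite and $$\gamma_d^2(T)\le \frac{n-2\sqrt{n}+d+1}{d}.$$ The bound is sharp: for every integer $s\ge 0$, let $T$ be the graph obtained from the star $K_{1,ds}$ by attaching $s$ copies of the path $P_d$ on $d$ vertices to every vertex of the star (each copy attached by an edge from the star vertex to an end-vertex of the path). Then $T$ is a tree of order $n=(ds+1)^2$ and $$\gamma_d^2(T)=1+ds^2=\frac{n-2\sqrt{n}+d+1}{d}.$$ -/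

import Mathlib

namespace SimpleGraph

/-- `X` is a `d`-distance dominating set of `G`: every vertex outside `X` is at distance at most `d`
from some vertex of `X`. (`edist` is the graph distance, equal to `⊤` between different
components.) -/
def IsDistDominating {V : Type*} (G : SimpleGraph V) (d : ℕ) (X : Set V) : Prop :=
  ∀ u, u ∉ X → ∃ x ∈ X, G.edist u x ≤ (d : ℕ∞)

/-- `X` is a `p`-packing of `G`: distinct vertices of `X` are at distance at least `p + 1`. -/
def IsDistPacking {V : Type*} (G : SimpleGraph V) (p : ℕ) (X : Set V) : Prop :=
  ∀ u ∈ X, ∀ v ∈ X, u ≠ v → ((p + 1 : ℕ) : ℕ∞) ≤ G.edist u v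

/-- The `d`-distance `p`-packing domination number `γ_d^p(G)`: the minimum size of a set of vertices
that is both a `d`-distance dominating set and a `p`-packing, and `⊤` if there is no such set. -/
noncomputable def distPackingDominationNumber {V : Type*} (G : SimpleGraph V) (d p : ℕ) : ℕ∞ :=
  ⨅ X ∈ {X : Set V | G.IsDistDominating d X ∧ G.IsDistPacking p X}, X.encard

/-- The graph obtained from `G` by attaching `s` copies of the path `P_d` (on `d` vertices) to every
vertex of `G`: `Sum.inr (w, i, j)` is the `j`-th vertex of the `i`-th path attached at `w`, and `w`
is joined to the first vertex (`j = 0`) of each path attached at `w`. -/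
def attachPaths {W : Type*} (G : SimpleGraph W) (s d : ℕ) :
    SimpleGraph (W ⊕ W × Fin s × Fin d) where
  Adj
    | Sum.inl u, Sum.inl v => G.Adj u v
    | Sum.inl u, Sum.inr (w, _, j) => u = w ∧ (j : ℕ) = 0
    | Sum.inr (w, _, j), Sum.inl u => u = w ∧ (j : ℕ) = 0
    | Sum.inr (w, i, j), Sum.inr (w', i', j') => w = w' ∧ i = i' ∧ (pathGraph d).Adj j j'
  symm := ⟨by
    rintro (u | ⟨w, i, j⟩) (v | ⟨w', i', j'⟩) h
    · exact G.adj_symm h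
    · exact h
    · exact h
    · exact ⟨h.1.symm, h.2.1.symm, (pathGraph d).adj_symm h.2.2⟩⟩
  loopless := ⟨by
    rintro (u | ⟨w, i, j⟩) h
    · exact G.loopless.irrefl _ h
    · exact (pathGraph d).loopless.irrefl _ h.2.2⟩

/-- The graph obtained from the star `K_{1,ds}` (on `ds + 1` vertices, with centre `0`) by attaching
`s` copies of `P_d` to every vertex. -/
def starWithPaths (d s : ℕ) :
    SimpleGraph (Fin (d * s + 1) ⊕ Fin (d * s + 1) × Fin s × Fin d) :=
  (starGraph (0 : Fin (d * s + 1))).attachPaths s d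

end SimpleGraph

namespace SimpleGraph

variable {V : Type*} {G : SimpleGraph V} {U : Finset V} {d : ℕ}

/-! Cut the tree along edges as long as both sides keep more than `d` vertices. Each final piece has
a vertex `c` all of whose branches have at most `d` vertices
(`exists_adj_or_exists_forall_card_closerTo_le`). Let `b` be the maximum of 1 and the number of its
branches with exactly `d` vertices; the piece has at least `d * b + 1` vertices. On its own it is
dominated by `c`; once a vertex outside is chosen, at most `b` further vertices finish it, wherever
that vertex lies (`hasPieces_of_card_closerTo_le`).

Use only the centre in the most expensive piece and extend across the cuts to the others. With `m`
pieces, total cost `B` and largest cost `β` this takes at most `B - β + 1` vertices, while `n ≥ m +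
d * B` and `B ≤ m * β`. `HasPieces` records these invariants and survives gluing along an edge
(`hasPieces_of_closerTo`); AM-GM turns them into the square-root bound (`add_sqrt_bound`).

For sharpness, the far end of each attached path needs a chosen vertex on that path or at its star
vertex, and a 2-packing contains at most one star vertex. The matching upper bound is the general
inequality itself. -/

/-! ### Distances across an edge and between branches of a tree -/

theorem Walk.dist_add_one_add_dist_le_length (hG : G.Connected) {a b : V}
    (hab : ¬ (G.deleteEdges {s(a, b)}).Reachable a b) {u v : V} (p : G.Walk u v)
    (hu : (G.deleteEdges {s(a, b)}).Reachable u a)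
    (hv : ¬ (G.deleteEdges {s(a, b)}).Reachable v a) :
    G.dist u a + 1 + G.dist b v ≤ p.length := by
  induction p with
  | nil => exact absurd hu hv
  | @cons u u' v h p ih =>
    rw [Walk.length_cons]
    by_cases hu' : (G.deleteEdges {s(a, b)}).Reachable u' a
    · have h1 := ih hu' hv
      have h2 : G.dist u a ≤ G.dist u u' + G.dist u' a := hG.dist_triangle
      rw [dist_eq_one_iff_adj.mpr h] at h2
      omega
    -- The first step that leaves the side of `a` must be the deleted edge.
    · have hedge : s(u, u') = s(a, b) := by
        by_contra hne
        have hadj : (G.deleteEdges {s(a, b)}).Adj u u' := by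
          rw [deleteEdges_adj]
          exact ⟨h, by simpa using hne⟩
        exact hu' (hadj.symm.reachable.trans hu)
      rcases Sym2.eq_iff.mp hedge with ⟨rfl, rfl⟩ | ⟨rfl, rfl⟩
      · have := dist_le p
        rw [dist_self]
        omega
      · exact absurd hu.symm hab

theorem IsTree.dist_eq_of_reachable (hG : G.IsTree) {a b : V} (hab : G.Adj a b) {u v : V}
    (hu : (G.deleteEdges {s(a, b)}).Reachable u a)
    (hv : ¬ (G.deleteEdges {s(a, b)}).Reachable v a) :
    G.dist u v = G.dist u a + 1 + G.dist b v := by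
  have hbr : ¬ (G.deleteEdges {s(a, b)}).Reachable a b :=
    isBridge_iff.mp (isAcyclic_iff_forall_adj_isBridge.mp hG.isAcyclic hab)
  obtain ⟨p, hp⟩ := hG.connected.exists_walk_length_eq_dist u v
  have h1 := p.dist_add_one_add_dist_le_length hG.connected hbr hu hv
  have h2 : G.dist u v ≤ G.dist u a + G.dist a v := hG.connected.dist_triangle
  have h3 : G.dist a v ≤ G.dist a b + G.dist b v := hG.connected.dist_triangle
  rw [dist_eq_one_iff_adj.mpr hab] at h3
  omega

theorem IsTree.dist_adj (hG : G.IsTree) {a b : V} (hab : G.Adj a b) (u : V) :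
    G.dist u b = G.dist u a + 1 ∨ G.dist u a = G.dist u b + 1 := by
  have hbr : ¬ (G.deleteEdges {s(a, b)}).Reachable a b :=
    isBridge_iff.mp (isAcyclic_iff_forall_adj_isBridge.mp hG.isAcyclic hab)
  by_cases hu : (G.deleteEdges {s(a, b)}).Reachable u a
  · left
    simpa using hG.dist_eq_of_reachable hab hu (fun h => hbr h.symm)
  · right
    have := hG.dist_eq_of_reachable hab (Reachable.refl a) hu
    rw [dist_self, dist_comm, dist_comm (u := b)] at this
    omega

/-- In a tree, a path from one side of an edge to the other one uses that edge. -/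
theorem IsTree.dist_across (hG : G.IsTree) {a b : V} (hab : G.Adj a b) {u v : V}
    (hu : G.dist u a < G.dist u b) (hv : G.dist v b < G.dist v a) :
    G.dist u v = G.dist u a + 1 + G.dist b v := by
  have hbr : ¬ (G.deleteEdges {s(a, b)}).Reachable a b :=
    isBridge_iff.mp (isAcyclic_iff_forall_adj_isBridge.mp hG.isAcyclic hab)
  apply hG.dist_eq_of_reachable hab
  · by_contra h
    have := hG.dist_eq_of_reachable hab (Reachable.refl a) h
    rw [dist_self, dist_comm, dist_comm (u := b)] at this
    omega
  · intro h
    have := hG.dist_eq_of_reachable hab h (fun h => hbr h.symm)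
    rw [dist_self] at this
    omega

/-- The neighbour of `c` on a geodesic from `c` to `u`. -/
theorem Connected.exists_adj_dist_add_one (hG : G.Connected) {c u : V} (h : u ≠ c) :
    ∃ w, G.Adj c w ∧ G.dist u c = G.dist u w + 1 := by
  obtain ⟨p, hp⟩ := hG.exists_walk_length_eq_dist c u
  cases p with
  | nil => exact absurd rfl h
  | @cons _ w _ hw q =>
    refine ⟨w, hw, ?_⟩
    rw [Walk.length_cons] at hp
    have h1 := dist_le q
    have h2 : G.dist c u ≤ G.dist c w + G.dist w u := hG.dist_triangle
    rw [dist_eq_one_iff_adj.mpr hw] at h2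
    rw [dist_comm (u := u), dist_comm (u := u)]
    omega

theorem Connected.exists_between (hG : G.Connected) (c u : V) {i : ℕ} (hi : i ≤ G.dist u c) :
    ∃ x, G.dist x c = i ∧ G.dist u x + G.dist x c = G.dist u c := by
  induction h : G.dist u c - i generalizing u with
  | zero => exact ⟨u, by omega, by simp⟩
  | succ k ih =>
    have huc : c ≠ u := by
      rintro rfl
      simp at h
    obtain ⟨w, hw, hd⟩ := hG.exists_adj_dist_add_one huc
    rw [dist_comm, dist_comm (u := c)] at hd
    obtain ⟨x, hx, hxw⟩ := ih w (by omega) (by omega)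
    refine ⟨x, hx, ?_⟩
    have h1 : G.dist u x ≤ G.dist u w + G.dist w x := hG.dist_triangle
    have h2 : G.dist u c ≤ G.dist u x + G.dist x c := hG.dist_triangle
    rw [dist_eq_one_iff_adj.mpr hw] at h1
    omega

/-- `u` lies in at most one of the branches at `c`. -/
theorem IsTree.dist_lt_unique (hG : G.IsTree) {c w w' u : V} (hw : G.Adj c w) (hw' : G.Adj c w')
    (h : G.dist u w < G.dist u c) (h' : G.dist u w' < G.dist u c) : w = w' := by
  by_contra hne
  have h1 : G.dist w' c = 1 := dist_eq_one_iff_adj.mpr hw'.symm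
  have h2 : G.dist w' w ≠ 0 := by
    rw [Ne, hG.connected.dist_eq_zero_iff]
    exact fun h => hne h.symm
  have h3 := hG.dist_adj hw w'
  have h4 := hG.dist_across hw.symm h (v := w') (by omega)
  have h5 := hG.dist_adj hw u
  rw [dist_comm (u := c), h1] at h4
  omega

/-- Distances between different branches at `c`. -/
theorem IsTree.dist_through (hG : G.IsTree) {c w u v : V} (hw : G.Adj c w)
    (hu : G.dist u w < G.dist u c) (hv : ¬ G.dist v w < G.dist v c) :
    G.dist u v = G.dist u c + G.dist v c := by
  have h3 := hG.dist_adj hw v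
  have h4 := hG.dist_across hw.symm hu (v := v) (by omega)
  have h5 := hG.dist_adj hw u
  rw [dist_comm (u := c)] at h4
  omega

/-! ### Sides of an edge, and the invariant for pieces -/

open Classical in
/-- The vertices of `U` that are closer to `a` than to `b`. -/
noncomputable def closerTo (G : SimpleGraph V) (U : Finset V) (a b : V) : Finset V :=
  U.filter fun u => G.dist u a < G.dist u b

theorem mem_closerTo {a b u : V} :
    u ∈ G.closerTo U a b ↔ u ∈ U ∧ G.dist u a < G.dist u b := by
  simp [closerTo]

/-- `U` contains all vertices on geodesics between its vertices. -/
def DistConvex (G : SimpleGraph V) (U : Finset V) : Prop :=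
  ∀ u ∈ U, ∀ v ∈ U, ∀ x, G.dist u x + G.dist x v = G.dist u v → x ∈ U

/-- `X ⊆ U` is a `2`-packing which `d`-dominates `U`. -/
structure IsPackingDominating (G : SimpleGraph V) (d : ℕ) (U X : Finset V) :
    Prop where
  subset : X ⊆ U
  packing : ∀ u ∈ X, ∀ v ∈ X, u ≠ v → 3 ≤ G.dist u v
  dominating : ∀ u ∈ U, ∃ x ∈ X, G.dist u x ≤ d

/-- `X ⊆ U` is a `2`-packing which `d`-dominates `U` together with a vertex outside `U` that is
joined to `U` by a path of length `t` ending at `y`, and which has distance at least `3` from that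
vertex. -/
structure IsPackingDominatingFrom (G : SimpleGraph V) (d : ℕ) (U : Finset V) (y : V)
    (t : ℕ) (X : Finset V) : Prop where
  subset : X ⊆ U
  packing : ∀ u ∈ X, ∀ v ∈ X, u ≠ v → 3 ≤ G.dist u v
  three_le : ∀ x ∈ X, 3 ≤ G.dist x y + t
  dominating : ∀ u ∈ U, (∃ x ∈ X, G.dist u x ≤ d) ∨ G.dist u y + t ≤ d

/-- `U` behaves like a union of `m` pieces with costs of sum `B` and maximum `β`, where a piece of
cost `b` has at least `d * b + 1` vertices: the most expensive piece can be dominated by one vertex,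
and all of `U` can be dominated at cost `B` when a vertex outside of `U` is given. -/
def HasPieces (G : SimpleGraph V) (d : ℕ) (U : Finset V) : Prop :=
  ∃ m B β : ℕ, 1 ≤ m ∧ β ≤ B ∧ B ≤ m * β ∧ m + d * B ≤ U.card ∧
    (∃ X, G.IsPackingDominating d U X ∧ X.card + β ≤ B + 1) ∧
    ∀ y ∈ U, ∀ t, 1 ≤ t → ∃ X, G.IsPackingDominatingFrom d U y t X ∧ X.card ≤ B

theorem IsTree.mem_closerTo_or (hG : G.IsTree) {a b u : V} (hab : G.Adj a b) (hu : u ∈ U) :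
    u ∈ G.closerTo U a b ∨ u ∈ G.closerTo U b a := by
  have := hG.dist_adj hab u
  rw [mem_closerTo, mem_closerTo]
  rcases this with h | h
  · exact Or.inl ⟨hu, by omega⟩
  · exact Or.inr ⟨hu, by omega⟩

theorem IsTree.distConvex_closerTo (hG : G.IsTree) {a b : V} (hab : G.Adj a b)
    (hU : G.DistConvex U) : G.DistConvex (G.closerTo U a b) := by
  intro u hu v hv x hx
  rw [mem_closerTo] at hu hv
  have hxU := hU u hu.1 v hv.1 x hx
  rcases hG.mem_closerTo_or hab hxU with h | h
  · exact h
  · rw [mem_closerTo] at h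
    have h1 := hG.dist_across hab hu.2 h.2
    have h2 := hG.dist_across hab hv.2 h.2
    have h3 : G.dist u v ≤ G.dist u a + G.dist a v := hG.connected.dist_triangle
    rw [dist_comm (u := a)] at h3
    rw [dist_comm (u := x)] at hx
    omega

theorem self_mem_closerTo {a b : V} (hab : G.Adj a b) (ha : a ∈ U) : a ∈ G.closerTo U a b := by
  rw [mem_closerTo, dist_self, dist_eq_one_iff_adj.mpr hab]
  exact ⟨ha, one_pos⟩

theorem IsTree.card_closerTo_add (hG : G.IsTree) {a b : V} (hab : G.Adj a b) :
    (G.closerTo U a b).card + (G.closerTo U b a).card = U.card := by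
  classical
  rw [← Finset.card_union_of_disjoint]
  · congr 1
    ext u
    rw [Finset.mem_union]
    refine ⟨fun h => ?_, fun h => hG.mem_closerTo_or hab h⟩
    rcases h with h | h
    · exact (mem_closerTo.mp h).1
    · exact (mem_closerTo.mp h).1
  · rw [Finset.disjoint_left]
    intro u h h'
    rw [mem_closerTo] at h h'
    omega

/-! ### Gluing along an edge -/

/-- A dominating packing of one side of an edge, together with an extension to the other side. -/
theorem IsTree.exists_isPackingDominating (hG : G.IsTree) {a b : V} (hab : G.Adj a b) (ha : a ∈ U)
    {B : ℕ} {X : Finset V} (hX : G.IsPackingDominating d (G.closerTo U a b) X)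
    (hB : ∀ t, 1 ≤ t → ∃ Y, G.IsPackingDominatingFrom d (G.closerTo U b a) b t Y ∧ Y.card ≤ B) :
    ∃ Z, G.IsPackingDominating d U Z ∧ Z.card ≤ X.card + B := by
  classical
  obtain ⟨x₁, hx₁, -⟩ := hX.dominating a (self_mem_closerTo hab ha)
  obtain ⟨x₀, hx₀, hmin⟩ := X.exists_min_image (fun x => G.dist x a) ⟨x₁, hx₁⟩
  -- The vertex of `X` nearest to `a` plays the outside vertex: being at distance at least 3 from it
  -- forces the same for the rest of `X`.
  obtain ⟨Y, hY, hYB⟩ := hB (G.dist x₀ a + 1) (by omega)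
  have key : ∀ x ∈ X, ∀ y ∈ G.closerTo U b a, G.dist x y = G.dist x a + 1 + G.dist b y :=
    fun x hx y hy => hG.dist_across hab (mem_closerTo.mp (hX.subset hx)).2 (mem_closerTo.mp hy).2
  have far : ∀ x ∈ X, ∀ y ∈ Y, 3 ≤ G.dist x y := by
    intro x hx y hy
    have h1 := key x hx y (hY.subset hy)
    have h2 := hmin x hx
    have h3 := hY.three_le y hy
    rw [dist_comm] at h3
    omega
  refine ⟨X ∪ Y, ⟨?_, ?_, ?_⟩, (Finset.card_union_le _ _).trans (by omega)⟩
  · intro x hx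
    rcases Finset.mem_union.mp hx with hx | hx
    · exact (mem_closerTo.mp (hX.subset hx)).1
    · exact (mem_closerTo.mp (hY.subset hx)).1
  · intro u hu v hv huv
    rcases Finset.mem_union.mp hu with hu | hu <;> rcases Finset.mem_union.mp hv with hv | hv
    · exact hX.packing u hu v hv huv
    · exact far u hu v hv
    · rw [dist_comm]
      exact far v hv u hu
    · exact hY.packing u hu v hv huv
  · intro u hu
    rcases hG.mem_closerTo_or hab hu with hu | hu
    · obtain ⟨x, hx, h⟩ := hX.dominating u hu
      exact ⟨x, Finset.mem_union_left _ hx, h⟩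
    · rcases hY.dominating u hu with ⟨x, hx, h⟩ | h
      · exact ⟨x, Finset.mem_union_right _ hx, h⟩
      · refine ⟨x₀, Finset.mem_union_left _ hx₀, ?_⟩
        have h1 := key x₀ hx₀ u hu
        rw [dist_comm]
        rw [dist_comm] at h
        omega

/-- The far side sees both `X` and the given outside vertex, so it is extended relative to whichever
of them is nearest to `a`. -/
theorem IsTree.exists_isPackingDominatingFrom (hG : G.IsTree) {a b : V} (hab : G.Adj a b)
    {y : V} (hy : y ∈ G.closerTo U a b) {t : ℕ} {B : ℕ} {X : Finset V}
    (hX : G.IsPackingDominatingFrom d (G.closerTo U a b) y t X)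
    (hB : ∀ t, 1 ≤ t → ∃ Y, G.IsPackingDominatingFrom d (G.closerTo U b a) b t Y ∧ Y.card ≤ B) :
    ∃ Z, G.IsPackingDominatingFrom d U y t Z ∧ Z.card ≤ X.card + B := by
  classical
  -- `s` is the least distance to `a` from the outside vertex or from `X`, which may be empty.
  obtain ⟨s, hs, hst, hsX⟩ : ∃ s, (s = t + G.dist y a ∨ ∃ x ∈ X, s = G.dist x a) ∧
      s ≤ t + G.dist y a ∧ ∀ x ∈ X, s ≤ G.dist x a := by
    obtain ⟨s, hs, hmin⟩ := (insert (t + G.dist y a) (X.image fun x => G.dist x a)).exists_min_image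
      id ⟨_, Finset.mem_insert_self _ _⟩
    refine ⟨s, ?_, hmin _ (Finset.mem_insert_self _ _), fun x hx =>
      hmin _ (Finset.mem_insert_of_mem (Finset.mem_image_of_mem _ hx))⟩
    rcases Finset.mem_insert.mp hs with hs | hs
    · exact Or.inl hs
    · obtain ⟨x, hx, rfl⟩ := Finset.mem_image.mp hs
      exact Or.inr ⟨x, hx, rfl⟩
  obtain ⟨Y, hY, hYB⟩ := hB (s + 1) (by omega)
  have key : ∀ x ∈ G.closerTo U a b, ∀ y ∈ G.closerTo U b a,
      G.dist x y = G.dist x a + 1 + G.dist b y :=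
    fun x hx y hy => hG.dist_across hab (mem_closerTo.mp hx).2 (mem_closerTo.mp hy).2
  have far : ∀ x ∈ X, ∀ y ∈ Y, 3 ≤ G.dist x y := by
    intro x hx y hy
    have h1 := key x (hX.subset hx) y (hY.subset hy)
    have h2 := hsX x hx
    have h3 := hY.three_le y hy
    rw [dist_comm] at h3
    omega
  refine ⟨X ∪ Y, ⟨?_, ?_, ?_, ?_⟩, (Finset.card_union_le _ _).trans (by omega)⟩
  · intro x hx
    rcases Finset.mem_union.mp hx with hx | hx
    · exact (mem_closerTo.mp (hX.subset hx)).1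
    · exact (mem_closerTo.mp (hY.subset hx)).1
  · intro u hu v hv huv
    rcases Finset.mem_union.mp hu with hu | hu <;> rcases Finset.mem_union.mp hv with hv | hv
    · exact hX.packing u hu v hv huv
    · exact far u hu v hv
    · rw [dist_comm]
      exact far v hv u hu
    · exact hY.packing u hu v hv huv
  · intro x hx
    rcases Finset.mem_union.mp hx with hx | hx
    · exact hX.three_le x hx
    · have h1 := key y hy x (hY.subset hx)
      have h3 := hY.three_le x hx
      rw [dist_comm] at h3 ⊢
      omega
  · intro u hu
    rcases hG.mem_closerTo_or hab hu with hu | hu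
    · rcases hX.dominating u hu with ⟨x, hx, h⟩ | h
      · exact Or.inl ⟨x, Finset.mem_union_left _ hx, h⟩
      · exact Or.inr h
    · rcases hY.dominating u hu with ⟨x, hx, h⟩ | h
      · exact Or.inl ⟨x, Finset.mem_union_right _ hx, h⟩
      · rcases hs with hs | ⟨x, hx, hs⟩
        · right
          have h1 := key y hy u hu
          rw [dist_comm] at h ⊢
          omega
        · refine Or.inl ⟨x, Finset.mem_union_left _ hx, ?_⟩
          have h1 := key x (hX.subset hx) u hu
          rw [dist_comm] at h ⊢
          omega

/-- Piece counts and costs add. The side with the larger maximum keeps its cheap domination, and the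
other side is added at full cost. -/
theorem IsTree.hasPieces_of_closerTo (hG : G.IsTree) {a b : V} (hab : G.Adj a b)
    (ha : a ∈ U) (hb : b ∈ U) (h₁ : G.HasPieces d (G.closerTo U a b))
    (h₂ : G.HasPieces d (G.closerTo U b a)) : G.HasPieces d U := by
  obtain ⟨m₁, B₁, β₁, hm₁, hβ₁, hB₁, hc₁, ⟨X₁, hX₁, hX₁'⟩, hF₁⟩ := h₁
  obtain ⟨m₂, B₂, β₂, hm₂, hβ₂, hB₂, hc₂, ⟨X₂, hX₂, hX₂'⟩, hF₂⟩ := h₂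
  have ext₁ := hF₁ a (self_mem_closerTo hab ha)
  have ext₂ := hF₂ b (self_mem_closerTo hab.symm hb)
  refine ⟨m₁ + m₂, B₁ + B₂, max β₁ β₂, by omega, by omega, ?_, ?_, ?_, ?_⟩
  · have h1 : m₁ * β₁ ≤ m₁ * max β₁ β₂ := Nat.mul_le_mul_left _ (le_max_left _ _)
    have h2 : m₂ * β₂ ≤ m₂ * max β₁ β₂ := Nat.mul_le_mul_left _ (le_max_right _ _)
    rw [add_mul]
    omega
  · rw [← hG.card_closerTo_add hab, mul_add]
    omega
  · rcases le_total β₂ β₁ with h | h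
    · obtain ⟨Z, hZ, hZc⟩ := hG.exists_isPackingDominating hab ha hX₁ ext₂
      exact ⟨Z, hZ, by rw [max_eq_left h]; omega⟩
    · obtain ⟨Z, hZ, hZc⟩ := hG.exists_isPackingDominating hab.symm hb hX₂ ext₁
      exact ⟨Z, hZ, by rw [max_eq_right h]; omega⟩
  · intro y hy t ht
    rcases hG.mem_closerTo_or hab hy with hy | hy
    · obtain ⟨X, hX, hXc⟩ := hF₁ y hy t ht
      obtain ⟨Z, hZ, hZc⟩ := hG.exists_isPackingDominatingFrom hab hy hX ext₂
      exact ⟨Z, hZ, by omega⟩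
    · obtain ⟨X, hX, hXc⟩ := hF₂ y hy t ht
      obtain ⟨Z, hZ, hZc⟩ := hG.exists_isPackingDominatingFrom hab.symm hy hX ext₁
      exact ⟨Z, hZ, by omega⟩

/-! ### Branches at a vertex, and single pieces -/

theorem IsTree.exists_mem_closerTo (hG : G.IsTree) (hU : G.DistConvex U) {c u : V} (hc : c ∈ U)
    (hu : u ∈ U) (huc : u ≠ c) :
    ∃ w ∈ U, G.Adj c w ∧ u ∈ G.closerTo U w c := by
  obtain ⟨w, hw, h⟩ := hG.connected.exists_adj_dist_add_one huc
  have h1 : G.dist w c = 1 := dist_eq_one_iff_adj.mpr hw.symm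
  exact ⟨w, hU u hu c hc w (by omega), hw, mem_closerTo.mpr ⟨hu, by omega⟩⟩

theorem IsTree.mem_closerTo_of_between (hG : G.IsTree) (hU : G.DistConvex U) {c w u x : V}
    (hc : c ∈ U) (hw : G.Adj c w) (hu : u ∈ G.closerTo U w c)
    (hx : G.dist u x + G.dist x c = G.dist u c) (hxc : 1 ≤ G.dist x c) :
    x ∈ G.closerTo U w c := by
  rw [mem_closerTo] at hu ⊢
  refine ⟨hU u hu.1 c hc x hx, ?_⟩
  by_contra h
  have := hG.dist_through hw hu.2 h
  omega

/-- The geodesic from `u` to `c` has a vertex of the branch at each distance from 1 to `G.dist u c`.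
-/
theorem IsTree.dist_le_card_closerTo (hG : G.IsTree) (hU : G.DistConvex U) {c w u : V}
    (hc : c ∈ U) (hw : G.Adj c w) (hu : u ∈ G.closerTo U w c) :
    G.dist u c ≤ (G.closerTo U w c).card := by
  classical
  have hsub : Finset.Icc 1 (G.dist u c) ⊆ (G.closerTo U w c).image fun x => G.dist x c := by
    intro i hi
    rw [Finset.mem_Icc] at hi
    obtain ⟨x, hxi, hx⟩ := hG.connected.exists_between c u hi.2
    exact Finset.mem_image.mpr
      ⟨x, hG.mem_closerTo_of_between hU hc hw hu hx (by omega), hxi⟩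
  have h1 := (Finset.card_le_card hsub).trans Finset.card_image_le
  rwa [Nat.card_Icc, Nat.add_sub_cancel] at h1

theorem IsTree.exists_grandchild (hG : G.IsTree) (hU : G.DistConvex U) {c w : V} (hc : c ∈ U)
    (hw : G.Adj c w) (hcard : 2 ≤ (G.closerTo U w c).card) :
    ∃ x ∈ G.closerTo U w c, G.dist x c = 2 ∧ G.dist w x = 1 := by
  obtain ⟨u, hu, huw⟩ := Finset.exists_mem_ne hcard w
  have h1 := hG.connected.pos_dist_of_ne huw
  have h2 := (mem_closerTo.mp hu).2
  obtain ⟨x, hx2, hx⟩ := hG.connected.exists_between c u (i := 2) (by omega)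
  have hxm := hG.mem_closerTo_of_between hU hc hw hu hx (by omega)
  refine ⟨x, hxm, hx2, ?_⟩
  have h3 := hG.dist_adj hw x
  have h4 := (mem_closerTo.mp hxm).2
  rw [dist_comm]
  omega

/-- The neighbours of `c` in `U` whose branches in `U` have at least `d` vertices. -/
noncomputable def bigNeighbors (G : SimpleGraph V) (d : ℕ) (U : Finset V) (c : V) : Finset V :=
  open Classical in U.filter fun w => G.Adj c w ∧ d ≤ (G.closerTo U w c).card

theorem mem_bigNeighbors {c w : V} :
    w ∈ G.bigNeighbors d U c ↔ w ∈ U ∧ G.Adj c w ∧ d ≤ (G.closerTo U w c).card := by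
  simp [bigNeighbors]

/-- The branches are disjoint and miss `c`, which accounts for the extra 1. -/
theorem IsTree.mul_card_bigNeighbors_lt (hG : G.IsTree) {c : V} (hc : c ∈ U) :
    d * (G.bigNeighbors d U c).card + 1 ≤ U.card := by
  classical
  have hdis : ((G.bigNeighbors d U c : Finset V) : Set V).PairwiseDisjoint
      fun w => G.closerTo U w c := by
    intro w hw w' hw' hne
    rw [Function.onFun, Finset.disjoint_left]
    intro u hu hu'
    exact hne (hG.dist_lt_unique (mem_bigNeighbors.mp hw).2.1 (mem_bigNeighbors.mp hw').2.1
      (mem_closerTo.mp hu).2 (mem_closerTo.mp hu').2)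
  have h1 : ((G.bigNeighbors d U c).biUnion fun w => G.closerTo U w c) ⊆ U.erase c := by
    intro u hu
    obtain ⟨w, -, hu⟩ := Finset.mem_biUnion.mp hu
    rw [mem_closerTo] at hu
    refine Finset.mem_erase.mpr ⟨?_, hu.1⟩
    rintro rfl
    rw [dist_self] at hu
    omega
  have h2 := Finset.card_le_card h1
  rw [Finset.card_biUnion hdis, Finset.card_erase_of_mem hc] at h2
  have h3 := Finset.card_nsmul_le_sum (G.bigNeighbors d U c) (fun w => (G.closerTo U w c).card) d
    (fun w hw => (mem_bigNeighbors.mp hw).2.2)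
  rw [smul_eq_mul, mul_comm] at h3
  have h4 : 0 < U.card := Finset.card_pos.mpr ⟨c, hc⟩
  omega

/-- A set whose branches at a vertex `c` all have at most `d` vertices is a single piece. -/
theorem IsTree.hasPieces_of_card_closerTo_le (hG : G.IsTree) (hd : 2 ≤ d) (hU : G.DistConvex U)
    {c : V} (hc : c ∈ U) (hbr : ∀ w ∈ U, G.Adj c w → (G.closerTo U w c).card ≤ d)
    (hcard : d + 1 ≤ U.card) : G.HasPieces d U := by
  classical
  have hdist : ∀ u ∈ U, G.dist u c ≤ d := by
    intro u hu
    by_cases huc : u = c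
    · simp [huc]
    · obtain ⟨w, hwU, hw, huw⟩ := hG.exists_mem_closerTo hU hc hu huc
      exact (hG.dist_le_card_closerTo hU hc hw huw).trans (hbr w hwU hw)
  set N := G.bigNeighbors d U c with hN
  have hNcard : d * N.card + 1 ≤ U.card := hG.mul_card_bigNeighbors_lt hc
  have hsmall : ∀ w ∈ U, G.Adj c w → w ∉ N → ∀ u ∈ G.closerTo U w c, G.dist u c + 1 ≤ d := by
    intro w hwU hw hwN u hu
    have h1 := hG.dist_le_card_closerTo hU hc hw hu
    rw [hN, mem_bigNeighbors] at hwN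
    by_contra h
    exact hwN ⟨hwU, hw, by omega⟩
  -- A big branch is dominated by a vertex at distance 2 from `c`; two of these in different
  -- branches are at distance 4. Such a vertex exists because `2 ≤ d`; outside `N` the value `c` is
  -- a dummy.
  have hf : ∀ w, ∃ x, w ∈ N → x ∈ G.closerTo U w c ∧ G.dist x c = 2 ∧ G.dist w x = 1 := by
    intro w
    by_cases hw : w ∈ N
    · obtain ⟨-, hcw, hwc⟩ := mem_bigNeighbors.mp hw
      obtain ⟨x, hx⟩ := hG.exists_grandchild hU hc hcw (by omega)
      exact ⟨x, fun _ => hx⟩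
    · exact ⟨c, fun h => absurd h hw⟩
  choose f hf using hf
  have hNadj : ∀ w ∈ N, G.Adj c w := fun w hw => (mem_bigNeighbors.mp hw).2.1
  have hfU : ∀ w ∈ N, f w ∈ U := fun w hw => (mem_closerTo.mp (hf w hw).1).1
  have hthrough : ∀ w₁ w₂, G.Adj c w₁ → G.Adj c w₂ → w₁ ≠ w₂ → ∀ u ∈ G.closerTo U w₁ c,
      ∀ v ∈ G.closerTo U w₂ c, G.dist u v = G.dist u c + G.dist v c := by
    intro w₁ w₂ h₁ h₂ hne u hu v hv
    exact hG.dist_through h₁ (mem_closerTo.mp hu).2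
      fun h => hne (hG.dist_lt_unique h₁ h₂ h (mem_closerTo.mp hv).2)
  have hpack : ∀ w₁ ∈ N, ∀ w₂ ∈ N, f w₁ ≠ f w₂ → 3 ≤ G.dist (f w₁) (f w₂) := by
    intro w₁ h₁ w₂ h₂ hne
    have h3 := hthrough w₁ w₂ (hNadj _ h₁) (hNadj _ h₂) (fun h => hne (h ▸ rfl))
      _ (hf w₁ h₁).1 _ (hf w₂ h₂).1
    rw [(hf w₁ h₁).2.1, (hf w₂ h₂).2.1] at h3
    omega
  have hdom : ∀ w ∈ N, ∀ u ∈ G.closerTo U w c, G.dist u (f w) ≤ d := by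
    intro w hw u hu
    have h1 : G.dist u (f w) ≤ G.dist u w + G.dist w (f w) := hG.connected.dist_triangle
    have h2 := (mem_closerTo.mp hu).2
    have h3 := hdist u (mem_closerTo.mp hu).1
    rw [(hf w hw).2.2] at h1
    omega
  have hself : ∀ w ∈ U, G.Adj c w → w ∈ G.closerTo U w c :=
    fun w hwU hw => self_mem_closerTo hw.symm hwU
  refine ⟨1, max 1 N.card, max 1 N.card, le_rfl, le_rfl, by omega, ?_, ?_, ?_⟩
  · rcases le_total 1 N.card with h | h
    · rw [max_eq_right h]
      omega
    · rw [max_eq_left h]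
      omega
  · refine ⟨{c}, ⟨by simpa using hc, ?_, fun u hu => ⟨c, by simp, hdist u hu⟩⟩, by simp; omega⟩
    simp
  · intro y hy t ht
    -- The cases are by the distance from the outside vertex to `c`. From 3 on, `c` itself may be
    -- chosen.
    by_cases hs : 3 ≤ G.dist c y + t
    · exact ⟨{c}, ⟨by simpa using hc, by simp, by simpa using hs,
        fun u hu => Or.inl ⟨c, by simp, hdist u hu⟩⟩, by simp⟩
    -- At distance 1 the outside vertex dominates `c` and all small branches, so only the big
    -- branches need a vertex.
    by_cases hs1 : G.dist c y + t = 1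
    · obtain rfl : c = y := hG.connected.dist_eq_zero_iff.mp (by omega)
      refine ⟨N.image f, ⟨?_, ?_, ?_, ?_⟩, Finset.card_image_le.trans (le_max_right _ _)⟩
      · intro x hx
        obtain ⟨w, hw, rfl⟩ := Finset.mem_image.mp hx
        exact hfU w hw
      · intro x hx x' hx' hne
        obtain ⟨w, hw, rfl⟩ := Finset.mem_image.mp hx
        obtain ⟨w', hw', rfl⟩ := Finset.mem_image.mp hx'
        exact hpack w hw w' hw' hne
      · intro x hx
        obtain ⟨w, hw, rfl⟩ := Finset.mem_image.mp hx
        rw [(hf w hw).2.1]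
        omega
      · intro u hu
        by_cases huc : u = c
        · right
          rw [huc, dist_self]
          omega
        · obtain ⟨w, hwU, hw, huw⟩ := hG.exists_mem_closerTo hU hc hu huc
          by_cases hwN : w ∈ N
          · exact Or.inl ⟨f w, Finset.mem_image_of_mem _ hwN, hdom w hwN u huw⟩
          · right
            have := hsmall w hwU hw hwN u huw
            omega
    have hs2 : G.dist c y + t = 2 := by omega
    -- At distance 2 the outside vertex dominates `c` and, if `y ≠ c`, the branch of `y`; `E`
    -- indexes the other branches.
    set E := U.filter fun w => G.Adj c w ∧ w ≠ y with hE
    have hout : ∀ w ∈ E, ∀ u ∈ G.closerTo U w c, G.dist u y = G.dist u c + G.dist c y := by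
      intro w hw u hu
      obtain ⟨hwU, hcw, hwy⟩ := Finset.mem_filter.mp hw
      have h1 := hG.dist_through hcw (mem_closerTo.mp hu).2 (v := y) ?_
      · rw [h1, dist_comm (u := y)]
      · intro h
        rw [dist_comm (v := c)] at h
        exact hwy (hG.connected.dist_eq_zero_iff.mp (by rw [dist_comm]; omega))
    have hcy : G.dist c y + t ≤ d := by omega
    have hcase : ∀ u ∈ U, G.dist u y + t ≤ d ∨ ∃ w ∈ E, u ∈ G.closerTo U w c := by
      intro u hu
      by_cases huc : u = c
      · exact Or.inl (by rw [huc]; exact hcy)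
      obtain ⟨w, hwU, hw, huw⟩ := hG.exists_mem_closerTo hU hc hu huc
      by_cases hwy : w = y
      · subst hwy
        left
        have h1 := (mem_closerTo.mp huw).2
        have h2 := hdist u hu
        rw [dist_eq_one_iff_adj.mpr hw] at hs2
        omega
      · exact Or.inr ⟨w, Finset.mem_filter.mpr ⟨hwU, hw, hwy⟩, huw⟩
    rcases E.eq_empty_or_nonempty with hE0 | hEne
    · refine ⟨∅, ⟨by simp, by simp, by simp, ?_⟩, by simp⟩
      intro u hu
      rcases hcase u hu with h | ⟨w, hw, -⟩
      · exact Or.inr h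
      · rw [hE0] at hw
        simp at hw
    -- One neighbour `w₀` of `c` dominates its own branch and every small branch. Taking it in a big
    -- branch when possible saves that branch's vertex and keeps the total within `max 1 N.card`.
    obtain ⟨w₀, hw₀, hbig⟩ : ∃ w₀ ∈ E, ((N ∩ E).Nonempty → w₀ ∈ N ∩ E) := by
      by_cases h : (N ∩ E).Nonempty
      · obtain ⟨w₀, h₀⟩ := h
        exact ⟨w₀, (Finset.mem_inter.mp h₀).2, fun _ => h₀⟩
      · obtain ⟨w₀, h₀⟩ := hEne
        exact ⟨w₀, h₀, fun h' => absurd h' h⟩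
    obtain ⟨hw₀U, hcw₀, -⟩ := Finset.mem_filter.mp hw₀
    have hw₀c : G.dist w₀ c = 1 := dist_eq_one_iff_adj.mpr hcw₀.symm
    have hM : ∀ w ∈ (N ∩ E).erase w₀, w ≠ w₀ ∧ w ∈ N ∧ w ∈ E := fun w hw =>
      ⟨Finset.ne_of_mem_erase hw, Finset.mem_inter.mp (Finset.mem_of_mem_erase hw)⟩
    have hw₀f : ∀ w ∈ (N ∩ E).erase w₀, 3 ≤ G.dist w₀ (f w) := by
      intro w hw
      obtain ⟨hne, hwN, hwE⟩ := hM w hw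
      have := hthrough w₀ w hcw₀ (hNadj w hwN) hne.symm _ (hself w₀ hw₀U hcw₀) _ (hf w hwN).1
      rw [(hf w hwN).2.1] at this
      omega
    refine ⟨insert w₀ (((N ∩ E).erase w₀).image f), ⟨?_, ?_, ?_, ?_⟩, ?_⟩
    · intro x hx
      rcases Finset.mem_insert.mp hx with rfl | hx
      · exact hw₀U
      · obtain ⟨w, hw, rfl⟩ := Finset.mem_image.mp hx
        exact hfU w (hM w hw).2.1
    · intro x hx x' hx' hne
      rcases Finset.mem_insert.mp hx with rfl | hx <;>
        rcases Finset.mem_insert.mp hx' with rfl | hx'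
      · exact absurd rfl hne
      · obtain ⟨w, hw, rfl⟩ := Finset.mem_image.mp hx'
        exact hw₀f w hw
      · obtain ⟨w, hw, rfl⟩ := Finset.mem_image.mp hx
        rw [dist_comm]
        exact hw₀f w hw
      · obtain ⟨w, hw, rfl⟩ := Finset.mem_image.mp hx
        obtain ⟨w', hw', rfl⟩ := Finset.mem_image.mp hx'
        exact hpack w (hM w hw).2.1 w' (hM w' hw').2.1 hne
    · intro x hx
      rcases Finset.mem_insert.mp hx with rfl | hx
      · have := hout x hw₀ x (hself x hw₀U hcw₀)
        omega
      · obtain ⟨w, hw, rfl⟩ := Finset.mem_image.mp hx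
        have h1 := hout w (hM w hw).2.2 _ (hf w (hM w hw).2.1).1
        have h2 := (hf w (hM w hw).2.1).2.1
        omega
    · intro u hu
      rcases hcase u hu with h | ⟨w, hw, huw⟩
      · exact Or.inr h
      left
      by_cases hww : w = w₀
      · subst hww
        refine ⟨w, Finset.mem_insert_self _ _, ?_⟩
        have h1 := (mem_closerTo.mp huw).2
        have h2 := hdist u hu
        omega
      by_cases hwN : w ∈ N
      · exact ⟨f w, Finset.mem_insert_of_mem (Finset.mem_image_of_mem _
          (Finset.mem_erase.mpr ⟨hww, Finset.mem_inter.mpr ⟨hwN, hw⟩⟩)), hdom w hwN u huw⟩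
      · refine ⟨w₀, Finset.mem_insert_self _ _, ?_⟩
        obtain ⟨hwU, hcw, -⟩ := Finset.mem_filter.mp hw
        have h1 := hsmall w hwU hcw hwN u huw
        have h2 : G.dist u w₀ ≤ G.dist u c + G.dist c w₀ := hG.connected.dist_triangle
        rw [dist_comm (u := c)] at h2
        omega
    · have h1 := Finset.card_insert_le w₀ (((N ∩ E).erase w₀).image f)
      have h2 : (((N ∩ E).erase w₀).image f).card ≤ _ := Finset.card_image_le
      have h3 : (N ∩ E).card ≤ N.card := Finset.card_le_card Finset.inter_subset_left
      rcases (N ∩ E).eq_empty_or_nonempty with h | h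
      · rw [h] at h1 h2 ⊢
        simp at h1 h2 ⊢
      · have h4 := Finset.card_erase_add_one (hbig h)
        have h5 := le_max_right 1 N.card
        omega

/-- Either some edge splits `U` into two parts with more than `d` vertices, or all branches at some
vertex have at most `d` vertices. -/
theorem IsTree.exists_adj_or_exists_forall_card_closerTo_le (hG : G.IsTree) (hne : U.Nonempty) :
    (∃ a ∈ U, ∃ b ∈ U, G.Adj a b ∧ d + 1 ≤ (G.closerTo U a b).card ∧
      d + 1 ≤ (G.closerTo U b a).card) ∨
    ∃ c ∈ U, ∀ w ∈ U, G.Adj c w → (G.closerTo U w c).card ≤ d := by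
  classical
  by_contra! h
  obtain ⟨hsplit, hbad⟩ := h
  let P := (U ×ˢ U).filter fun p => G.Adj p.1 p.2 ∧ d < (G.closerTo U p.2 p.1).card
  have hP : ∀ c w, (c, w) ∈ P ↔ c ∈ U ∧ w ∈ U ∧ G.Adj c w ∧ d < (G.closerTo U w c).card := by
    simp [P, and_assoc]
  obtain ⟨c₀, hc₀⟩ := hne
  obtain ⟨w₀, hw₀, h₀⟩ := hbad c₀ hc₀
  -- Take a smallest branch with more than `d` vertices. A large branch at `w` either points back to
  -- `c`, so the edge splits `U`, or lies inside this branch and misses `w`, against minimality.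
  obtain ⟨⟨c, w⟩, hcw, hmin⟩ := P.exists_min_image (fun p => (G.closerTo U p.2 p.1).card)
    ⟨(c₀, w₀), (hP _ _).mpr ⟨hc₀, hw₀, h₀⟩⟩
  obtain ⟨hc, hw, hadj, hbig⟩ := (hP _ _).mp hcw
  obtain ⟨w', hw', hadj', hbig'⟩ := hbad w hw
  have hle : (G.closerTo U w c).card ≤ (G.closerTo U w' w).card :=
    hmin (w, w') ((hP _ _).mpr ⟨hw, hw', hadj', hbig'⟩)
  by_cases hcw' : w' = c
  · subst hcw'
    exact absurd (hsplit w' hc w hw hadj hbig') (by omega)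
  · refine hle.not_gt (Finset.card_lt_card ⟨?_, ?_⟩)
    · intro u hu
      rw [mem_closerTo] at hu ⊢
      refine ⟨hu.1, ?_⟩
      rcases hG.dist_adj hadj u with h | h
      · exact absurd (hG.dist_lt_unique hadj' hadj.symm hu.2 (by omega)) hcw'
      · omega
    · intro hsub
      have := (mem_closerTo.mp (hsub (self_mem_closerTo hadj.symm hw))).2
      rw [dist_self] at this
      omega

theorem IsTree.hasPieces (hG : G.IsTree) (hd : 2 ≤ d) (hU : G.DistConvex U)
    (hcard : d + 1 ≤ U.card) : G.HasPieces d U := by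
  induction h : U.card using Nat.strong_induction_on generalizing U with
  | _ n ih =>
    rcases hG.exists_adj_or_exists_forall_card_closerTo_le (d := d)
      (Finset.card_pos.mp (by omega : 0 < U.card)) with
      ⟨a, ha, b, hb, hab, h1, h2⟩ | ⟨c, hc, hbr⟩
    · have hsum := hG.card_closerTo_add (U := U) hab
      exact hG.hasPieces_of_closerTo hab ha hb
        (ih _ (by omega) (hG.distConvex_closerTo hab hU) h1 rfl)
        (ih _ (by omega) (hG.distConvex_closerTo hab.symm hU) h2 rfl)
    · exact hG.hasPieces_of_card_closerTo_le hd hU hc hbr hcard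

/-! ### The general upper bound -/

theorem add_sqrt_bound {d n m B β k : ℕ} (hd : 1 ≤ d) (hm : 1 ≤ m) (hB : B ≤ m * β)
    (hn : m + d * B ≤ n) (hk : k + β ≤ B + 1) :
    (k : ℝ) ≤ ((n : ℝ) - 2 * Real.sqrt (n : ℝ) + (d : ℝ) + 1) / (d : ℝ) := by
  have hd0 : (0 : ℝ) < d := by exact_mod_cast hd
  have hm' : (1 : ℝ) ≤ m := by exact_mod_cast hm
  have hB' : (B : ℝ) ≤ m * β := by exact_mod_cast hB
  have hn' : (m : ℝ) + d * B ≤ n := by exact_mod_cast hn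
  have hk' : (k : ℝ) + β ≤ B + 1 := by exact_mod_cast hk
  set r := Real.sqrt (n : ℝ) with hr
  have hr2 : r ^ 2 = n := Real.sq_sqrt (Nat.cast_nonneg n)
  have hr1 : 1 ≤ r := by
    rw [hr, Real.one_le_sqrt]
    nlinarith [mul_nonneg hd0.le (Nat.cast_nonneg (α := ℝ) B)]
  rw [le_div_iff₀ hd0]
  by_contra! h
  -- The negated bound, as `n - 2√n + 1 = (r - 1) ^ 2`. It makes the product of `m - 1` and `d * β`
  -- exceed `(r - 1) ^ 2` while their sum is below `2 * (r - 1)`, contradicting AM-GM.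
  have h1 : (r - 1) ^ 2 < d * (k - 1) := by nlinarith
  have h2 : d * ((k : ℝ) - 1) ≤ d * ((m - 1) * β) :=
    mul_le_mul_of_nonneg_left (by linarith) hd0.le
  have h3 : d * ((k : ℝ) - 1) ≤ d * B - d * β := by
    rw [← mul_sub]
    exact mul_le_mul_of_nonneg_left (by linarith) hd0.le
  have h4 : (r - 1) ^ 2 < (m - 1) * (d * β) := by nlinarith
  have h5 : (m - 1) + d * β < 2 * (r - 1) := by nlinarith
  have h6 : 0 ≤ (m - 1) + (d : ℝ) * β := by linarith [mul_nonneg hd0.le (Nat.cast_nonneg (α := ℝ) β)]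
  nlinarith [sq_nonneg ((m - 1) - (d : ℝ) * β)]

theorem IsPackingDominating.distPackingDominationNumber_le [Fintype V] (hG : G.Connected)
    {X : Finset V} (hX : G.IsPackingDominating d Finset.univ X) :
    G.distPackingDominationNumber d 2 ≤ X.card := by
  rw [← Set.encard_coe_eq_coe_finsetCard]
  refine iInf₂_le (X : Set V) ⟨fun u _ => ?_, fun u hu v hv huv => ?_⟩
  · obtain ⟨x, hx, h⟩ := hX.dominating u (Finset.mem_univ u)
    refine ⟨x, hx, ?_⟩
    rw [← (hG u x).coe_dist_eq_edist]
    exact_mod_cast h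
  · rw [← (hG u v).coe_dist_eq_edist]
    exact_mod_cast hX.packing u hu v hv huv

theorem IsTree.exists_isPackingDominating_univ [Fintype V] (hG : G.IsTree) (hd : 2 ≤ d) :
    ∃ X, G.IsPackingDominating d Finset.univ X ∧
      (X.card : ℝ) ≤ ((Fintype.card V : ℝ) - 2 * Real.sqrt (Fintype.card V : ℝ) + (d : ℝ) + 1) /
        (d : ℝ) := by
  obtain ⟨v⟩ := hG.connected.nonempty
  rcases le_or_gt (Fintype.card V) d with h | h
  · refine ⟨{v}, ⟨by simp, by simp, fun u _ => ⟨v, by simp, ?_⟩⟩, ?_⟩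
    · obtain ⟨p, hp, hpl⟩ := hG.connected.exists_path_of_dist u v
      rw [← hpl]
      exact (hp.length_lt.trans_le h).le
    -- With at most `d` vertices one vertex suffices, which corresponds to a single piece of cost 0.
    · exact add_sqrt_bound (B := 0) (β := 0) (m := 1) (by omega) le_rfl le_rfl
        (by simpa using Nat.succ_le_of_lt (Fintype.card_pos_iff.mpr ⟨v⟩)) (by simp)
  · obtain ⟨m, B, β, hm, -, hB, hn, ⟨X, hX, hk⟩, -⟩ :=
      hG.hasPieces (U := Finset.univ) hd (fun _ _ _ _ _ _ => Finset.mem_univ _) h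
    exact ⟨X, hX, add_sqrt_bound (by omega) hm hB hn hk⟩

theorem IsTree.exists_distPackingDominationNumber_eq [Fintype V] (hG : G.IsTree) (hd : 2 ≤ d) :
    ∃ k : ℕ, G.distPackingDominationNumber d 2 = (k : ℕ∞) ∧
      (k : ℝ) ≤ ((Fintype.card V : ℝ) - 2 * Real.sqrt (Fintype.card V : ℝ) + (d : ℝ) + 1) /
        (d : ℝ) := by
  obtain ⟨X, hX, hXc⟩ := hG.exists_isPackingDominating_univ hd
  have hle := hX.distPackingDominationNumber_le hG.connected
  obtain ⟨k, hk⟩ := ENat.ne_top_iff_exists.mp (hle.trans_lt (ENat.natCast_lt_top _)).ne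
  refine ⟨k, hk.symm, le_trans ?_ hXc⟩
  rw [← hk] at hle
  exact_mod_cast hle

/-! ### Sharpness: stars with attached paths -/

theorem Connected.le_add_dist (hG : G.Connected) {f : V → ℕ}
    (hf : ∀ u v, G.Adj u v → f v ≤ f u + 1) (u v : V) : f v ≤ f u + G.dist u v := by
  obtain ⟨p, hp⟩ := hG.exists_walk_length_eq_dist u v
  rw [← hp]
  clear hp
  induction p with
  | nil => simp
  | cons h p ih =>
    have := hf _ _ h
    rw [Walk.length_cons]
    omega

section starWithPaths

variable {s : ℕ}

theorem starWithPaths_adj_center {w : Fin (d * s + 1)} (hw : w ≠ 0) :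
    (starWithPaths d s).Adj (Sum.inl w) (Sum.inl 0) :=
  starGraph_adj.mpr ⟨hw, Or.inr rfl⟩

theorem starWithPaths_adj_zero (w : Fin (d * s + 1)) (i : Fin s) (hd : 0 < d) :
    (starWithPaths d s).Adj (Sum.inr (w, i, ⟨0, hd⟩)) (Sum.inl w) :=
  ⟨rfl, rfl⟩

theorem starWithPaths_adj_succ (w : Fin (d * s + 1)) (i : Fin s) {j : ℕ} (hj : j + 1 < d) :
    (starWithPaths d s).Adj (Sum.inr (w, i, ⟨j + 1, hj⟩)) (Sum.inr (w, i, ⟨j, by omega⟩)) :=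
  ⟨rfl, rfl, pathGraph_adj.mpr (Or.inr rfl)⟩

theorem starWithPaths_connected (d s : ℕ) : (starWithPaths d s).Connected := by
  have h : ∀ v, (starWithPaths d s).Reachable v (Sum.inl 0) := by
    have hl : ∀ w, (starWithPaths d s).Reachable (Sum.inl w) (Sum.inl 0) := by
      intro w
      by_cases hw : w = 0
      · rw [hw]
      · exact (starWithPaths_adj_center hw).reachable
    rintro (w | ⟨w, i, j, hj⟩)
    · exact hl w
    · induction j with
      | zero => exact (starWithPaths_adj_zero w i hj).reachable.trans (hl w)
      | succ j ih => exact (starWithPaths_adj_succ w i hj).reachable.trans (ih _)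
  exact { preconnected := fun u v => (h u).trans (h v).symm, nonempty := ⟨Sum.inl 0⟩ }

/-- The next vertex on the path to the centre. -/
def starWithPathsParent (d s : ℕ) :
    Fin (d * s + 1) ⊕ Fin (d * s + 1) × Fin s × Fin d →
      Fin (d * s + 1) ⊕ Fin (d * s + 1) × Fin s × Fin d
  | Sum.inl _ => Sum.inl 0
  | Sum.inr (w, _, ⟨0, _⟩) => Sum.inl w
  | Sum.inr (w, i, ⟨j + 1, hj⟩) => Sum.inr (w, i, ⟨j, by omega⟩)

theorem starWithPaths_eq_parent_or {u v} (h : (starWithPaths d s).Adj u v) :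
    (u ≠ Sum.inl 0 ∧ v = starWithPathsParent d s u) ∨
      (v ≠ Sum.inl 0 ∧ u = starWithPathsParent d s v) := by
  rcases u with u | ⟨u, i, j, hj⟩ <;> rcases v with v | ⟨v, i', j', hj'⟩
  · obtain ⟨hne, rfl | rfl⟩ := starGraph_adj.mp h
    · exact Or.inr ⟨fun h => hne (Sum.inl.inj h).symm, rfl⟩
    · exact Or.inl ⟨fun h => hne (Sum.inl.inj h), rfl⟩
  · obtain ⟨rfl, rfl : j' = 0⟩ := h
    exact Or.inr ⟨Sum.inr_ne_inl, rfl⟩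
  · obtain ⟨rfl, rfl : j = 0⟩ := h
    exact Or.inl ⟨Sum.inr_ne_inl, rfl⟩
  · obtain ⟨rfl, rfl, h⟩ := h
    rcases pathGraph_adj.mp h with rfl | rfl
    · exact Or.inr ⟨Sum.inr_ne_inl, rfl⟩
    · exact Or.inl ⟨Sum.inr_ne_inl, rfl⟩

/-- Every edge joins a vertex other than the centre to its parent, so a connected graph with this
few edges is a tree. -/
theorem starWithPaths_isTree (d s : ℕ) : (starWithPaths d s).IsTree := by
  have hconn := starWithPaths_connected d s
  refine isTree_iff_connected_and_card.mpr
    ⟨hconn, le_antisymm ?_ hconn.card_vert_le_card_edgeSet_add_one⟩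
  have hsub : (starWithPaths d s).edgeSet ⊆
      (fun v => s(v, starWithPathsParent d s v)) '' (Set.univ \ {Sum.inl 0}) := by
    intro e
    induction e with
    | _ u v =>
      intro h
      rcases starWithPaths_eq_parent_or h with ⟨h0, h1⟩ | ⟨h0, h1⟩
      · exact ⟨u, ⟨trivial, h0⟩, congrArg (fun x => s(u, x)) h1.symm⟩
      · exact ⟨v, ⟨trivial, h0⟩, Sym2.eq_swap.trans (congrArg (fun x => s(x, v)) h1.symm)⟩
  have h1 := (Set.ncard_le_ncard hsub (Set.toFinite _)).trans (Set.ncard_image_le (Set.toFinite _))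
  rw [← Nat.card_coe_set_eq] at h1
  have h2 := Set.ncard_sdiff_singleton_add_one
    (Set.mem_univ (Sum.inl 0 : Fin (d * s + 1) ⊕ Fin (d * s + 1) × Fin s × Fin d))
    (Set.toFinite _)
  rw [Set.ncard_univ] at h2
  omega

/-- The far end of an attached path is only dominated from that path and from the vertex that the
path is attached to. -/
theorem mem_of_isDistDominating_starWithPaths (hd : 1 ≤ d)
    {X : Set (Fin (d * s + 1) ⊕ Fin (d * s + 1) × Fin s × Fin d)}
    (hX : (starWithPaths d s).IsDistDominating d X) (w : Fin (d * s + 1)) (i : Fin s) :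
    Sum.inl w ∈ X ∨ ∃ j, Sum.inr (w, i, j) ∈ X := by
  -- `f` is the distance from the far end of the path, truncated at `d + 1`; being 1-Lipschitz, it
  -- bounds that distance from below.
  set f : Fin (d * s + 1) ⊕ Fin (d * s + 1) × Fin s × Fin d → ℕ := fun v =>
    match v with
    | Sum.inl u => if u = w then d else d + 1
    | Sum.inr (u, k, j) => if u = w ∧ k = i then d - 1 - j else d + 1 with hf
  have hlip : ∀ u v, (starWithPaths d s).Adj u v → f v ≤ f u + 1 := by
    rintro (u | ⟨u, k, j, hj⟩) (v | ⟨v, k', j', hj'⟩) h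
    · simp only [hf]
      split_ifs <;> omega
    · obtain ⟨rfl, rfl : j' = 0⟩ := h
      simp only [hf]
      split_ifs <;> omega
    · obtain ⟨rfl, rfl : j = 0⟩ := h
      simp only [hf]
      split_ifs <;> omega
    · obtain ⟨rfl, rfl, h⟩ := h
      have := pathGraph_adj.mp h
      simp only at this
      simp only [hf]
      split_ifs <;> omega
  by_contra! hno
  obtain ⟨h0, h1⟩ := hno
  obtain ⟨x, hx, hdist⟩ := hX (Sum.inr (w, i, ⟨d - 1, by omega⟩)) (h1 _)
  have hconn := starWithPaths_connected d s
  rw [← (hconn _ _).coe_dist_eq_edist] at hdist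
  have hdist' : (starWithPaths d s).dist (Sum.inr (w, i, ⟨d - 1, by omega⟩)) x ≤ d := by
    exact_mod_cast hdist
  have h2 := hconn.le_add_dist hlip (Sum.inr (w, i, ⟨d - 1, by omega⟩)) x
  have h3 : f (Sum.inr (w, i, ⟨d - 1, by omega⟩)) = 0 := by simp [hf]
  have h4 : f x = d + 1 := by
    rcases x with u | ⟨u, k, j⟩
    · have : u ≠ w := by
        rintro rfl
        exact h0 hx
      simp [hf, this]
    · have : ¬ (u = w ∧ k = i) := by
        rintro ⟨rfl, rfl⟩
        exact h1 j hx
      simp [hf, this]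
  omega

theorem le_encard_of_isDistDominating_starWithPaths (hd : 1 ≤ d)
    {X : Set (Fin (d * s + 1) ⊕ Fin (d * s + 1) × Fin s × Fin d)}
    (hX : (starWithPaths d s).IsDistDominating d X) (hX' : (starWithPaths d s).IsDistPacking 2 X) :
    ((1 + d * s ^ 2 : ℕ) : ℕ∞) ≤ X.encard := by
  classical
  have hmem := mem_of_isDistDominating_starWithPaths hd hX
  obtain ⟨F, rfl⟩ : ∃ F : Finset _, X = (F : Set _) := ⟨X.toFinite.toFinset, by simp⟩
  simp only [Finset.mem_coe] at hmem
  rw [Set.encard_coe_eq_coe_finsetCard, Nat.cast_le]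
  -- Counting labels: `none` for star vertices, otherwise the attached path containing the vertex.
  let g : Fin (d * s + 1) ⊕ Fin (d * s + 1) × Fin s × Fin d → Option (Fin (d * s + 1) × Fin s) :=
    Sum.elim (fun _ => none) fun p => some (p.1, p.2.1)
  refine le_trans ?_ (Finset.card_image_le (f := g))
  by_cases hA : ∃ w₀, Sum.inl w₀ ∈ F
  · obtain ⟨w₀, hw₀⟩ := hA
    -- Star vertices are pairwise within distance 2, so the other `d * s` of them are not chosen and
    -- each contributes `s` paths.
    have huniq : ∀ w, Sum.inl w ∈ F → w = w₀ := by
      intro w hw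
      by_contra hne
      have h1 := hX' _ hw _ hw₀ (fun h => hne (Sum.inl.inj h))
      have hconn := starWithPaths_connected d s
      rw [← (hconn _ _).coe_dist_eq_edist, Nat.cast_le] at h1
      have hle : ∀ u, (starWithPaths d s).dist (Sum.inl u) (Sum.inl 0) ≤ 1 := by
        intro u
        by_cases hu : u = 0
        · simp [hu]
        · exact (dist_eq_one_iff_adj.mpr (starWithPaths_adj_center hu)).le
      have h2 := hle w
      have h3 := hle w₀
      have h4 : (starWithPaths d s).dist (Sum.inl w) (Sum.inl w₀) ≤ _ :=
        hconn.dist_triangle (v := Sum.inl 0)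
      rw [dist_comm] at h3
      omega
    have hsub : insert none (((Finset.univ.erase w₀) ×ˢ (Finset.univ : Finset (Fin s))).image some)
        ⊆ F.image g := by
      intro o ho
      rcases Finset.mem_insert.mp ho with rfl | ho
      · exact Finset.mem_image.mpr ⟨_, hw₀, rfl⟩
      · obtain ⟨⟨w, i⟩, hwi, rfl⟩ := Finset.mem_image.mp ho
        have hw := Finset.ne_of_mem_erase (Finset.mem_product.mp hwi).1
        rcases hmem w i with h | ⟨j, h⟩
        · exact absurd (huniq w h) hw
        · exact Finset.mem_image.mpr ⟨_, h, rfl⟩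
    refine le_trans (le_of_eq ?_) (Finset.card_le_card hsub)
    rw [Finset.card_insert_of_notMem (by simp), Finset.card_image_of_injective _
      (Option.some_injective _), Finset.card_product, Finset.card_erase_of_mem (Finset.mem_univ _)]
    simp
    ring
  · push Not at hA
    have hsub : (Finset.univ : Finset (Fin (d * s + 1) × Fin s)).image some ⊆ F.image g := by
      intro o ho
      obtain ⟨⟨w, i⟩, -, rfl⟩ := Finset.mem_image.mp ho
      rcases hmem w i with h | ⟨j, h⟩
      · exact absurd h (hA w)
      · exact Finset.mem_image.mpr ⟨_, h, rfl⟩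
    have hcard := Finset.card_le_card hsub
    rw [Finset.card_image_of_injective _ (Option.some_injective _)] at hcard
    simp only [Finset.card_univ, Fintype.card_prod, Fintype.card_fin] at hcard
    -- All `(d * s + 1) * s = d * s ^ 2 + s` paths are hit, which is enough unless `s = 0`; then
    -- nonemptiness gives the missing 1.
    rcases Nat.eq_zero_or_pos s with hs | hs
    · obtain ⟨x, hx, -⟩ := hX (Sum.inl 0) (hA 0)
      have := Finset.card_pos.mpr ⟨g x, Finset.mem_image_of_mem g hx⟩
      have h0 : d * s ^ 2 = 0 := by simp [hs]
      omega
    · nlinarith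

theorem card_starWithPaths (d s : ℕ) :
    Fintype.card (Fin (d * s + 1) ⊕ Fin (d * s + 1) × Fin s × Fin d) = (d * s + 1) ^ 2 := by
  simp only [Fintype.card_sum, Fintype.card_prod, Fintype.card_fin]
  ring

theorem one_add_mul_sq_eq (hd : 1 ≤ d) (s : ℕ) :
    ((1 + d * s ^ 2 : ℕ) : ℝ) = ((((d * s + 1) ^ 2 : ℕ) : ℝ) -
      2 * Real.sqrt (((d * s + 1) ^ 2 : ℕ) : ℝ) + (d : ℝ) + 1) / (d : ℝ) := by
  have hd0 : (d : ℝ) ≠ 0 := by exact_mod_cast (by omega : d ≠ 0)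
  rw [eq_div_iff hd0, Nat.cast_pow, Real.sqrt_sq (Nat.cast_nonneg _)]
  push_cast
  ring

theorem distPackingDominationNumber_starWithPaths (hd : 2 ≤ d) (s : ℕ) :
    (starWithPaths d s).distPackingDominationNumber d 2 = ((1 + d * s ^ 2 : ℕ) : ℕ∞) := by
  obtain ⟨k, hk, hle⟩ := (starWithPaths_isTree d s).exists_distPackingDominationNumber_eq hd
  rw [card_starWithPaths, ← one_add_mul_sq_eq (by omega) s, Nat.cast_le] at hle
  apply le_antisymm
  · rw [hk]
    exact_mod_cast hle
  · exact le_iInf₂ fun X hX => le_encard_of_isDistDominating_starWithPaths (by omega) hX.1 hX.2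

end starWithPaths

end SimpleGraph

theorem theorem4 (d : ℕ) (hd : 2 ≤ d) :
    (∀ (V : Type*) [Fintype V] (T : SimpleGraph V), T.IsTree →
      ∃ k : ℕ, T.distPackingDominationNumber d 2 = (k : ℕ∞) ∧
        (k : ℝ) ≤ ((Fintype.card V : ℝ) - 2 * Real.sqrt (Fintype.card V : ℝ) + (d : ℝ) + 1) /
          (d : ℝ)) ∧
    (∀ s n : ℕ,
      n = Fintype.card (Fin (d * s + 1) ⊕ Fin (d * s + 1) × Fin s × Fin d) →
      (SimpleGraph.starWithPaths d s).IsTree ∧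
      n = (d * s + 1) ^ 2 ∧
      ∃ k : ℕ, (SimpleGraph.starWithPaths d s).distPackingDominationNumber d 2 = (k : ℕ∞) ∧
        k = 1 + d * s ^ 2 ∧
        (k : ℝ) = ((n : ℝ) - 2 * Real.sqrt (n : ℝ) + (d : ℝ) + 1) / (d : ℝ)) := by
  refine ⟨fun V _ T hT => hT.exists_distPackingDominationNumber_eq hd, fun s n hn => ?_⟩
  rw [SimpleGraph.card_starWithPaths] at hn
  subst hn
  exact ⟨SimpleGraph.starWithPaths_isTree d s, rfl, 1 + d * s ^ 2,
    SimpleGraph.distPackingDominationNumber_starWithPaths hd s, rfl,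
    SimpleGraph.one_add_mul_sq_eq (by omega) s⟩
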